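/- All graphs are finite, simple and undirected, and need not be connected. A set $F$ of edges of a graph $G$ is an edge-cut if $G-F$ is disconnected; it separates two vertices $x,y$ if $x$ and $y$ lie in different components of $G-F$. An edge-cut is a matching cut if no two of its edges share an endpoint. Given an edge-coloring $c:E(G)\to\{1,\dots,k\}$ (not necessarily proper), an edge-cut $F$ is a proper edge-cut if any two adjacent edges of $F$ have different colors, and the edge-colored graph is proper disconnected if any two distinct vertices are separated by some proper edge-cut. The proper disconnection number $\mathrm{pd}(G)$ is the least $k\ge 1$ such that some edge-coloring of $G$ with $k$ colors makes $G$ proper disconnected. **Theorem.** Let $G$ be a graph with maximum degree $\Delta(G)=3$. Then $\mathrm{pd}(G)\le 2$. Moreover, $\mathrm{pd}(G)=1$ if and only if any two distinct vertices of $G$ are separated by a matching cut of $G$; otherwise $\mathrm{pd}(G)=2$. -/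

import Mathlib

namespace ProperDisconnection

variable {V : Type*}

/-- `F` is an edge-cut of `G`: a set of edges of `G` whose removal leaves a disconnected graph. -/
def IsEdgeCut (G : SimpleGraph V) (F : Set (Sym2 V)) : Prop :=
  F ⊆ G.edgeSet ∧ ¬ (G.deleteEdges F).Connected

/-- `F` separates `x` and `y` in `G`: they lie in different components of `G - F`. -/
def Separates (G : SimpleGraph V) (F : Set (Sym2 V)) (x y : V) : Prop :=
  ¬ (G.deleteEdges F).Reachable x y

/-- `F` is a proper edge-cut of `G` under the edge-coloring `c`: it is an edge-cut, and any two
adjacent edges (distinct edges with a common end) in `F` have different colors. -/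
def IsProperEdgeCut (G : SimpleGraph V) {K : Type*} (c : G.EdgeLabeling K)
    (F : Set (Sym2 V)) : Prop :=
  IsEdgeCut G F ∧
    ∀ e f : G.edgeSet, (e : Sym2 V) ∈ F → (f : Sym2 V) ∈ F → e ≠ f →
      (∃ v : V, v ∈ (e : Sym2 V) ∧ v ∈ (f : Sym2 V)) → c e ≠ c f

/-- The edge-colored graph `(G, c)` is proper disconnected: each pair of distinct vertices is
separated by a proper edge-cut. -/
def IsProperDisconnected (G : SimpleGraph V) {K : Type*} (c : G.EdgeLabeling K) : Prop :=
  ∀ x y : V, x ≠ y → ∃ F : Set (Sym2 V), IsProperEdgeCut G c F ∧ Separates G F x y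

/-- The proper disconnection number `pd(G)`: the least positive `k` such that some edge-coloring
of `G` with `k` available colors makes `G` proper disconnected. -/
noncomputable def pd (G : SimpleGraph V) : ℕ :=
  sInf {k : ℕ | 0 < k ∧ ∃ c : G.EdgeLabeling (Fin k), IsProperDisconnected G c}

/-- `F` is a matching cut of `G`: an edge-cut no two distinct edges of which have a common end. -/
def IsMatchingCut (G : SimpleGraph V) (F : Set (Sym2 V)) : Prop :=
  IsEdgeCut G F ∧
    ∀ e ∈ F, ∀ f ∈ F, e ≠ f → ¬ ∃ v : V, v ∈ e ∧ v ∈ f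

/-- For a finite graph the minimum in the definition of `pd` is over a nonempty set. -/
theorem pd_set_nonempty [Finite V] (G : SimpleGraph V) :
    {k : ℕ | 0 < k ∧ ∃ c : G.EdgeLabeling (Fin k), IsProperDisconnected G c}.Nonempty := by
  classical
  have : Fintype G.edgeSet := Fintype.ofFinite _
  refine ⟨Fintype.card G.edgeSet + 1, Nat.succ_pos _,
    fun e => (Fintype.equivFin G.edgeSet e).castSucc, ?_⟩
  intro x y hxy
  have hbot : G.deleteEdges G.edgeSet = ⊥ := by
    ext u v
    simp [SimpleGraph.deleteEdges_adj]
  have hsep : ¬ (G.deleteEdges G.edgeSet).Reachable x y := by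
    rw [hbot, SimpleGraph.reachable_bot]
    exact hxy
  refine ⟨G.edgeSet, ⟨⟨subset_rfl, fun h => hsep (h.preconnected x y)⟩, ?_⟩, hsep⟩
  intro e f _ _ hef _ h
  exact hef ((Fintype.equivFin G.edgeSet).injective (Fin.castSucc_injective _ h))

end ProperDisconnection

/-!
The content of the theorem is that two colours suffice whenever all degrees are at most `3`; the
rest is that, with one colour, proper edge-cuts are matching cuts.

Bridges can be deleted: a bridge alone separates any two vertices on different sides of it, and a
proper cut of the graph without the bridge, taken within one side, is a proper cut of the whole
graph (`HasProperSides.of_deleteEdges_bridge`).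

Let `G` be bridgeless, and suppose that a matching `M` covers all vertices of degree `3` and contains
an edge of each triangle. Colour `M` with one colour and the other edges with the second. A vertex
has at most two edges outside `M`, and a cut is proper as soon as no vertex has two such edges in
it. To separate `x` from `y`, cut off `{x}` if `x` has at most one edge outside `M`, and `{x, x'}`
otherwise, where `xx'` is an edge outside `M` with `x' ≠ y`. In the second case a vertex with two
edges outside `M` in the cut would form a triangle avoiding `M` with `x` and `x'`
(`hasProperSides_of_matching`).

Such an `M` exists (`exists_matching_meeting_triangles`). Contract each member of a maximal family
of disjoint triangles to a vertex. The resulting multigraph is again bridgeless with degrees at most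
`3`, so by Petersen's theorem, derived from Tutte's theorem in `exists_matching_of_cut_ne_one`, it has
a matching that covers all its vertices of degree `3`. This matching lifts to `G`. It meets a
contracted triangle in at most one vertex, so the edge joining two other vertices of the triangle can
be added. A triangle outside the family shares an edge `ab` with a member `aby` of the family; if
`abc` avoided `M`, then `M` would have to cover both `a` and `b` from `y`.
-/

namespace ProperDisconnection

/-! ### Cuts given by one of their sides -/

section Sides

variable {V : Type*}

/-- `S` is one side of a cut in which two edges with a common end never have the same colour.
The colouring is defined on all unordered pairs, so that it makes sense for every graph on `V`. -/
def IsProperSide (G : SimpleGraph V) (c : Sym2 V → Bool) (S : Set V) : Prop :=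
  ∀ v u w, G.Adj v u → G.Adj v w → u ≠ w → ¬ (v ∈ S ↔ u ∈ S) → ¬ (v ∈ S ↔ w ∈ S) →
    c s(v, u) ≠ c s(v, w)

/-- Any two distinct vertices lie on different sides of a cut that is proper for `c`. -/
def HasProperSides (G : SimpleGraph V) (c : Sym2 V → Bool) : Prop :=
  ∀ x y, x ≠ y → ∃ S : Set V, x ∈ S ∧ y ∉ S ∧ IsProperSide G c S

/-- The edges of `G` with exactly one end in `S`. -/
def cutEdges (G : SimpleGraph V) (S : Set V) : Set (Sym2 V) :=
  {e | ∃ u v, G.Adj u v ∧ u ∈ S ∧ v ∉ S ∧ e = s(u, v)}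

theorem exists_of_mem_cutEdges {G : SimpleGraph V} {S : Set V} {e : Sym2 V} {v : V}
    (he : e ∈ cutEdges G S) (hv : v ∈ e) :
    ∃ w, e = s(v, w) ∧ G.Adj v w ∧ ¬ (v ∈ S ↔ w ∈ S) := by
  obtain ⟨a, b, hab, ha, hb, rfl⟩ := he
  rcases Sym2.mem_iff.1 hv with rfl | rfl
  · exact ⟨b, rfl, hab, by tauto⟩
  · exact ⟨a, Sym2.eq_swap, hab.symm, by tauto⟩

theorem separates_cutEdges (G : SimpleGraph V) {S : Set V} {x y : V} (hx : x ∈ S) (hy : y ∉ S) :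
    Separates G (cutEdges G S) x y := by
  rintro ⟨p⟩
  induction p with
  | nil => exact hy hx
  | @cons u v w h p ih =>
    rw [SimpleGraph.deleteEdges_adj] at h
    by_cases hv : v ∈ S
    · exact ih hv hy
    · exact h.2 ⟨u, v, h.1, hx, hv, rfl⟩

theorem HasProperSides.isProperDisconnected {G : SimpleGraph V} {c : Sym2 V → Bool}
    (h : HasProperSides G c) :
    IsProperDisconnected G (K := Fin 2) (fun e => if c e then 1 else 0) := by
  intro x y hxy
  obtain ⟨S, hx, hy, hS⟩ := h x y hxy
  have hsep := separates_cutEdges G hx hy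
  refine ⟨cutEdges G S, ⟨⟨?_, fun hc => hsep (hc.preconnected x y)⟩, ?_⟩, hsep⟩
  · rintro e ⟨u, v, huv, -, -, rfl⟩
    exact huv
  · rintro ⟨e, he⟩ ⟨f, hf⟩ heS hfS hef ⟨v, hve, hvf⟩ hcol
    obtain ⟨u, rfl, hu, hus⟩ := exists_of_mem_cutEdges heS hve
    obtain ⟨w, rfl, hw, hws⟩ := exists_of_mem_cutEdges hfS hvf
    have huw : u ≠ w := by rintro rfl; exact hef rfl
    have := hS v u w hu hw huw hus hws
    dsimp only at hcol
    split_ifs at hcol <;> simp_all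

/-! ### Bridges -/

/-- If `ab` is the only edge leaving `K`, then a proper cut of `G - ab` that separates two vertices
of `K` can be moved inside `K`, by putting all of `Kᶜ` on the side of `a`. -/
theorem exists_properSide_of_mem {G : SimpleGraph V} {c : Sym2 V → Bool} {K : Set V} {a b : V}
    (ha : a ∈ K) (hb : b ∉ K) (hK : ∀ u v, G.Adj u v → u ∈ K → v ∉ K → u = a ∧ v = b)
    (h : HasProperSides (G.deleteEdges {s(a, b)}) c) {x y : V} (hxy : x ≠ y)
    (hx : x ∈ K) (hy : y ∈ K) : ∃ S : Set V, x ∈ S ∧ y ∉ S ∧ IsProperSide G c S := by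
  obtain ⟨S, hxS, hyS, hS⟩ := h x y hxy
  set T : Set V := {v | (v ∈ K ∧ v ∈ S) ∨ (v ∉ K ∧ a ∈ S)} with hT
  have key : ∀ u v, G.Adj u v → ¬ (u ∈ T ↔ v ∈ T) →
      (G.deleteEdges {s(a, b)}).Adj u v ∧ ¬ (u ∈ S ↔ v ∈ S) := by
    intro u v huv hne
    simp only [hT, Set.mem_ofPred_eq] at hne
    have h1 := hK u v huv
    have h2 := hK v u huv.symm
    by_cases hu : u ∈ K <;> by_cases hv : v ∈ K
    · refine ⟨?_, by tauto⟩
      rw [SimpleGraph.deleteEdges_adj]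
      refine ⟨huv, fun hmem => hb ?_⟩
      rcases Sym2.eq_iff.1 (Set.mem_singleton_iff.1 hmem) with ⟨-, rfl⟩ | ⟨rfl, -⟩ <;> assumption
    · obtain ⟨rfl, rfl⟩ := h1 hu hv
      tauto
    · obtain ⟨rfl, rfl⟩ := h2 hv hu
      tauto
    · tauto
  refine ⟨T, Or.inl ⟨hx, hxS⟩, by simp [hT, hy, hyS], ?_⟩
  intro v u w hu hw huw hus hws
  exact hS v u w (key v u hu hus).1 (key v w hw hws).1 huw (key v u hu hus).2 (key v w hw hws).2

/-- A colouring that works after the deletion of a bridge works before: the bridge on its own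
separates any two vertices on different sides of it. -/
theorem HasProperSides.of_deleteEdges_bridge {G : SimpleGraph V} {c : Sym2 V → Bool} {K : Set V}
    {a b : V} (ha : a ∈ K) (hb : b ∉ K)
    (hK : ∀ u v, G.Adj u v → u ∈ K → v ∉ K → u = a ∧ v = b)
    (h : HasProperSides (G.deleteEdges {s(a, b)}) c) : HasProperSides G c := by
  have hK' : ∀ u v, G.Adj u v → u ∈ Kᶜ → v ∉ Kᶜ → u = b ∧ v = a := fun u v huv hu hv =>
    (hK v u huv.symm (not_not.1 hv) hu).symm
  have hside : IsProperSide G c K := by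
    intro v u w hu hw huw hus hws
    have := hK v u hu
    have := hK v w hw
    have := hK u v hu.symm
    have := hK w v hw.symm
    grind
  intro x y hxy
  by_cases hx : x ∈ K <;> by_cases hy : y ∈ K
  · exact exists_properSide_of_mem ha hb hK h hxy hx hy
  · exact ⟨K, hx, hy, hside⟩
  · refine ⟨Kᶜ, hx, not_not.2 hy, fun v u w hu hw huw hus hws => hside v u w hu hw huw ?_ ?_⟩
    · simpa only [Set.mem_compl_iff, not_iff_not] using hus
    · simpa only [Set.mem_compl_iff, not_iff_not] using hws
  · exact exists_properSide_of_mem (K := Kᶜ) (a := b) (b := a) hb (not_not.2 ha) hK'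
      (by rwa [Sym2.eq_swap]) hxy hx hy

/-! ### The colouring given by a matching -/

open scoped Classical in
theorem filter_adj_eq_of_card_le_three [Fintype V] {G : SimpleGraph V} {v x y z : V}
    (hdeg : (Finset.univ.filter (G.Adj v)).card ≤ 3) (hx : G.Adj v x) (hy : G.Adj v y)
    (hz : G.Adj v z) (hxy : x ≠ y) (hxz : x ≠ z) (hyz : y ≠ z) :
    Finset.univ.filter (G.Adj v) = {x, y, z} := by
  have hsub : ({x, y, z} : Finset V) ⊆ Finset.univ.filter (G.Adj v) := by
    intro u hu
    simp only [Finset.mem_insert, Finset.mem_singleton] at hu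
    rcases hu with rfl | rfl | rfl <;> simpa
  have hcard : ({x, y, z} : Finset V).card = 3 :=
    Finset.card_eq_three.2 ⟨x, y, z, hxy, hxz, hyz, rfl⟩
  exact (Finset.eq_of_subset_of_card_le hsub (hcard ▸ hdeg)).symm

open scoped Classical in
/-- Colour the edges of the matching `M` with one colour and all other edges of `G` with the
other. Matching edges may be cut freely, and each vertex has at most two other edges. If `x` has at
most one of them, `{x}` is a proper side; otherwise `{x, x'}` is one for each neighbour `x'` of `x`
along them, because no triangle avoids `M`. -/
theorem hasProperSides_of_matching [Fintype V] {G M : SimpleGraph V}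
    (hdeg : ∀ v, (Finset.univ.filter (G.Adj v)).card ≤ 3)
    (hM : ∀ v u w, M.Adj v u → M.Adj v w → u = w)
    (hcov : ∀ v, (Finset.univ.filter (G.Adj v)).card = 3 → ∃ u, G.Adj v u ∧ M.Adj v u)
    (htri : ∀ a b c, G.Adj a b → G.Adj b c → G.Adj a c → M.Adj a b ∨ M.Adj b c ∨ M.Adj a c) :
    HasProperSides G (fun e => decide (e ∈ M.edgeSet)) := by
  have hB : ∀ v u₁ u₂ u₃, G.Adj v u₁ → ¬ M.Adj v u₁ → G.Adj v u₂ → ¬ M.Adj v u₂ →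
      G.Adj v u₃ → ¬ M.Adj v u₃ → u₁ ≠ u₂ → u₁ ≠ u₃ → u₂ ≠ u₃ → False := by
    intro v u₁ u₂ u₃ g₁ m₁ g₂ m₂ g₃ m₃ h12 h13 h23
    have heq := filter_adj_eq_of_card_le_three (hdeg v) g₁ g₂ g₃ h12 h13 h23
    obtain ⟨u, hu, hmu⟩ := hcov v (heq ▸ Finset.card_eq_three.2 ⟨u₁, u₂, u₃, h12, h13, h23, rfl⟩)
    have : u ∈ ({u₁, u₂, u₃} : Finset V) := by rw [← heq]; simpa
    simp only [Finset.mem_insert, Finset.mem_singleton] at this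
    rcases this with rfl | rfl | rfl <;> contradiction
  have hprop : ∀ S : Set V, (∀ v u w, G.Adj v u → ¬ M.Adj v u → G.Adj v w → ¬ M.Adj v w → u ≠ w →
      ¬ (v ∈ S ↔ u ∈ S) → ¬ (v ∈ S ↔ w ∈ S) → False) →
      IsProperSide G (fun e => decide (e ∈ M.edgeSet)) S := by
    intro S hS v u w hu hw huw hus hws hcol
    simp only [SimpleGraph.mem_edgeSet, decide_eq_decide] at hcol
    by_cases hmu : M.Adj v u
    · exact huw (hM v u w hmu (hcol.1 hmu))
    · exact hS v u w hu hmu hw (fun h => hmu (hcol.2 h)) huw hus hws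
  intro x y hxy
  by_cases hx : ∃ u w, u ≠ w ∧ (G.Adj x u ∧ ¬ M.Adj x u) ∧ (G.Adj x w ∧ ¬ M.Adj x w)
  · obtain ⟨x', hx'y, hg, hm⟩ : ∃ x', x' ≠ y ∧ G.Adj x x' ∧ ¬ M.Adj x x' := by
      obtain ⟨u, w, huw, hu, hw⟩ := hx
      by_cases h : u = y
      · exact ⟨w, fun h' => huw (h.trans h'.symm), hw⟩
      · exact ⟨u, h, hu⟩
    refine ⟨{x, x'}, by simp, by simp [hxy.symm, hx'y.symm], hprop _ ?_⟩
    intro v u w gu mu gw mw huw hus hws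
    simp only [Set.mem_insert_iff, Set.mem_singleton_iff] at hus hws
    by_cases hv : v = x
    · simp only [hv, true_or, true_iff, not_or] at hus hws gu mu gw mw
      exact hB x x' u w hg hm gu mu gw mw (Ne.symm hus.2) (Ne.symm hws.2) huw
    by_cases hv' : v = x'
    · simp only [hv', or_true, true_iff, not_or] at hus hws gu mu gw mw
      exact hB x' x u w hg.symm (fun h => hm h.symm) gu mu gw mw (Ne.symm hus.1) (Ne.symm hws.1)
        huw
    simp only [hv, hv', or_self, false_iff, not_not] at hus hws
    have key : G.Adj v x → ¬ M.Adj v x → G.Adj v x' → ¬ M.Adj v x' → False := by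
      intro g₁ m₁ g₂ m₂
      rcases htri v x x' g₁ hg g₂ with h | h | h
      exacts [m₁ h, hm h, m₂ h]
    rcases hus with rfl | rfl <;> rcases hws with rfl | rfl
    · exact huw rfl
    · exact key gu mu gw mw
    · exact key gw mw gu mu
    · exact huw rfl
  · refine ⟨{x}, rfl, hxy.symm, hprop _ ?_⟩
    intro v u w gu mu gw mw huw hus hws
    simp only [Set.mem_singleton_iff] at hus hws
    by_cases hv : v = x
    · subst hv
      exact hx ⟨u, w, huw, ⟨gu, mu⟩, gw, mw⟩
    · simp only [hv, false_iff, not_not] at hus hws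
      exact huw (hus.trans hws.symm)

end Sides

/-! ### Petersen's theorem for weighted graphs -/

section Petersen

variable {W : Type*}

theorem even_sum_sum_of_symm [DecidableEq W] {a : W → W → ℕ} (hsymm : ∀ u v, a u v = a v u)
    (hdiag : ∀ w, a w w = 0) (K : Finset W) : Even (∑ u ∈ K, ∑ v ∈ K, a u v) := by
  induction K using Finset.induction_on with
  | empty => simp
  | insert w K hw ih =>
    have h : ∑ u ∈ insert w K, ∑ v ∈ insert w K, a u v
        = 2 * ∑ v ∈ K, a w v + ∑ u ∈ K, ∑ v ∈ K, a u v := by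
      simp only [Finset.sum_insert hw, Finset.sum_add_distrib, hdiag, fun u => hsymm u w]
      ring
    rw [h]
    exact (even_two_mul _).add ih

/-- An odd set of vertices of degree `3` is left by an odd number of edges, hence by at least three
if no single edge is a cut. -/
theorem three_le_cut_of_odd_card [Fintype W] [DecidableEq W] {a : W → W → ℕ}
    (hsymm : ∀ u v, a u v = a v u) (hdiag : ∀ w, a w w = 0) {K : Finset W}
    (hcut : ∑ u ∈ K, ∑ v ∈ Kᶜ, a u v ≠ 1) (hdeg : ∀ w ∈ K, ∑ v, a w v = 3) (hK : Odd K.card) :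
    3 ≤ ∑ u ∈ K, ∑ v ∈ Kᶜ, a u v := by
  have h : ∑ u ∈ K, ∑ v ∈ K, a u v + ∑ u ∈ K, ∑ v ∈ Kᶜ, a u v = 3 * K.card := by
    rw [← Finset.sum_add_distrib, mul_comm, ← smul_eq_mul, ← Finset.sum_const]
    exact Finset.sum_congr rfl fun u hu => by rw [Finset.sum_add_sum_compl, hdeg u hu]
  obtain ⟨i, hi⟩ := even_sum_sum_of_symm hsymm hdiag K
  obtain ⟨j, hj⟩ := hK
  omega

/-- Disjoint sets, each sending weight at least `3` to `U`, number at most `U.card` if each vertex of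
`U` has degree at most `3`. -/
theorem card_le_of_three_le_sum [Fintype W] [DecidableEq W] {ι : Type*} {a : W → W → ℕ}
    (hsymm : ∀ u v, a u v = a v u) (hdeg : ∀ w, ∑ v, a w v ≤ 3) (U : Finset W) (s : Finset ι)
    (K : ι → Finset W) (hdisj : (s : Set ι).PairwiseDisjoint K)
    (h3 : ∀ i ∈ s, 3 ≤ ∑ u ∈ K i, ∑ v ∈ U, a u v) : s.card ≤ U.card := by
  have h : 3 * s.card ≤ 3 * U.card := calc
    3 * s.card = ∑ i ∈ s, 3 := by simp [mul_comm]
    _ ≤ ∑ i ∈ s, ∑ u ∈ K i, ∑ v ∈ U, a u v := Finset.sum_le_sum h3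
    _ = ∑ u ∈ s.biUnion K, ∑ v ∈ U, a u v := (Finset.sum_biUnion hdisj).symm
    _ ≤ ∑ u, ∑ v ∈ U, a u v := Finset.sum_le_sum_of_subset (Finset.subset_univ _)
    _ = ∑ v ∈ U, ∑ u, a v u := by
      rw [Finset.sum_comm]
      exact Finset.sum_congr rfl fun v _ => Finset.sum_congr rfl fun u _ => hsymm u v
    _ ≤ ∑ v ∈ U, 3 := Finset.sum_le_sum fun v _ => hdeg v
    _ = 3 * U.card := by simp [mul_comm]
  omega

/-- **Petersen's theorem** for multigraphs of maximum degree at most `3`, given by the number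
`a u v` of edges between `u` and `v`: without bridges, a matching covers every vertex of degree `3`.
Tutte's theorem is applied to the graph in which, in addition, the vertices of degree at most `2`
are pairwise adjacent: at most one odd component contains such a vertex, and each other odd
component is left by at least three edges. -/
theorem exists_matching_of_cut_ne_one [Fintype W] (hW : Even (Fintype.card W)) [DecidableEq W]
    {a : W → W → ℕ} (hsymm : ∀ u v, a u v = a v u) (hdiag : ∀ w, a w w = 0)
    (hdeg : ∀ w, ∑ v, a w v ≤ 3) (hcut : ∀ K : Finset W, ∑ u ∈ K, ∑ v ∈ Kᶜ, a u v ≠ 1) :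
    ∃ M : SimpleGraph W, (∀ u v, M.Adj u v → 0 < a u v) ∧
      (∀ v u w, M.Adj v u → M.Adj v w → u = w) ∧ ∀ w, ∑ v, a w v = 3 → ∃ v, M.Adj w v := by
  classical
  -- the degree conditions make `low w` say that `w` has degree at most `2`
  let low : W → Prop := fun w => ∑ v, a w v ≠ 3
  let H : SimpleGraph W :=
    { Adj := fun u v => u ≠ v ∧ (0 < a u v ∨ low u ∧ low v)
      symm := ⟨fun u v h => ⟨h.1.symm, by rw [hsymm v u]; exact h.2.imp_right And.symm⟩⟩
      loopless := ⟨fun u h => h.1 rfl⟩ }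
  obtain ⟨M, hM⟩ : ∃ M : H.Subgraph, M.IsPerfectMatching := by
    rw [SimpleGraph.tutte]
    intro U hU
    rw [SimpleGraph.IsTutteViolator] at hU
    set C := ((⊤ : H.Subgraph).deleteVerts U).coe with hC
    have hverts : ((⊤ : H.Subgraph).deleteVerts U).verts = Uᶜ := by
      simp [Set.compl_eq_univ_sdiff]
    have hadj : ∀ u v (hu : u ∈ ((⊤ : H.Subgraph).deleteVerts U).verts)
        (hv : v ∈ ((⊤ : H.Subgraph).deleteVerts U).verts), H.Adj u v →
        C.connectedComponentMk ⟨u, hu⟩ = C.connectedComponentMk ⟨v, hv⟩ := by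
      intro u v hu hv huv
      refine SimpleGraph.ConnectedComponent.connectedComponentMk_eq_of_adj ?_
      simp only [hverts, Set.mem_compl_iff] at hu hv
      simp [hC, hu, hv, huv]
    have hcard : U.ncard + 2 ≤ C.oddComponents.ncard := by
      have h1 := SimpleGraph.odd_ncard_oddComponents (G := C)
      have h2 : Nat.card ((⊤ : H.Subgraph).deleteVerts U).verts + U.ncard = Fintype.card W := by
        rw [Nat.card_coe_set_eq, hverts, add_comm, Set.ncard_add_ncard_compl,
          Nat.card_eq_fintype_card]
      have h3 := hW
      rw [← h2, Nat.even_add] at h3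
      by_contra hlt
      have h4 : C.oddComponents.ncard = U.ncard + 1 := by omega
      rw [h4, Nat.odd_add_one] at h1
      rw [← Nat.not_even_iff_odd, ← Nat.not_even_iff_odd] at h1
      tauto
    let K : C.ConnectedComponent → Finset W := fun c => (Subtype.val '' c.supp).toFinset
    have hmem : ∀ c w, w ∈ K c ↔ ∃ hw, C.connectedComponentMk ⟨w, hw⟩ = c := by
      intro c w
      simp [K]
    let O' := C.oddComponents.toFinset.filter fun c => ∀ w ∈ K c, ¬ low w
    have hO' : U.ncard + 1 ≤ O'.card := by
      have h1 : (C.oddComponents.toFinset.filter fun c => ¬ ∀ w ∈ K c, ¬ low w).card ≤ 1 := by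
        rw [Finset.card_le_one]
        intro c hc d hd
        simp only [Finset.mem_filter, not_forall, not_not] at hc hd
        obtain ⟨-, u, hu, hlu⟩ := hc
        obtain ⟨-, v, hv, hlv⟩ := hd
        obtain ⟨hu', rfl⟩ := (hmem _ _).1 hu
        obtain ⟨hv', rfl⟩ := (hmem _ _).1 hv
        by_cases huv : u = v
        · subst huv; rfl
        · exact hadj u v hu' hv' ⟨huv, Or.inr ⟨hlu, hlv⟩⟩
      have h2 : O'.card + (C.oddComponents.toFinset.filter fun c => ¬ ∀ w ∈ K c, ¬ low w).card
          = C.oddComponents.toFinset.card := Finset.card_filter_add_card_filter_not _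
      rw [← Set.ncard_eq_toFinset_card'] at h2
      omega
    have hle : O'.card ≤ U.toFinset.card := by
      refine card_le_of_three_le_sum hsymm hdeg U.toFinset O' K ?_ ?_
      · intro c _ d _ hcd
        refine Finset.disjoint_left.2 fun w hwc hwd => hcd ?_
        obtain ⟨_, rfl⟩ := (hmem _ _).1 hwc
        exact ((hmem _ _).1 hwd).2
      · intro c hc
        simp only [O', Finset.mem_filter, Set.mem_toFinset] at hc
        have hodd : Odd (K c).card := by
          have := hc.1
          rw [Set.mem_ofPred_eq, ← Set.ncard_image_of_injective _ Subtype.val_injective,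
            Set.ncard_eq_toFinset_card'] at this
          exact this
        refine (three_le_cut_of_odd_card hsymm hdiag (hcut _)
          (fun w hw => not_not.1 (hc.2 w hw)) hodd).trans (Finset.sum_le_sum fun u hu => ?_)
        refine Finset.sum_le_sum_of_ne_zero fun v hv hne => ?_
        rw [Set.mem_toFinset]
        by_contra hvU
        obtain ⟨hu', rfl⟩ := (hmem _ _).1 hu
        have hv' : v ∈ ((⊤ : H.Subgraph).deleteVerts U).verts := by rwa [hverts]
        refine Finset.mem_compl.1 hv ((hmem _ _).2 ⟨hv', (hadj u v hu' hv' ⟨?_, Or.inl ?_⟩).symm⟩)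
        · rintro rfl
          exact hne (hdiag _)
        · exact Nat.pos_of_ne_zero hne
    rw [← Set.ncard_eq_toFinset_card'] at hle
    omega
  refine ⟨{ Adj := fun u v => M.Adj u v ∧ 0 < a u v
            symm := ⟨fun u v h => ⟨h.1.symm, by rw [hsymm]; exact h.2⟩⟩
            loopless := ⟨fun u h => h.1.ne rfl⟩ }, fun u v h => h.2, ?_, ?_⟩
  · intro v u w hu hw
    exact (hM.1 (hM.2 v)).unique hu.1 hw.1
  · intro w hw
    obtain ⟨v, hv, -⟩ := hM.1 (hM.2 w)
    exact ⟨v, hv, hv.adj_sub.2.resolve_right fun h => h.1 hw⟩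

end Petersen

/-! ### Contraction of triangles -/

section Blocks

variable {V W : Type*}

/-- The vertices of a finite graph can be partitioned into triangles and singletons so that every
triangle of the graph meets a triangle of the partition; `r v` is the block of `v`. -/
theorem exists_triangle_blocks [Finite V] (G : SimpleGraph V) :
    ∃ r : V → Finset V, (∀ v, v ∈ r v) ∧ (∀ u v, u ∈ r v → r u = r v) ∧
      (∀ v, G.IsNClique 1 (r v) ∨ G.IsNClique 3 (r v)) ∧
      ∀ T, G.IsNClique 3 T → ∃ v ∈ T, G.IsNClique 3 (r v) := by
  classical
  have := Fintype.ofFinite V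
  -- a maximal family of pairwise disjoint triangles
  obtain ⟨𝓕, h𝓕⟩ : ∃ 𝓕 : Finset (Finset V), Maximal (fun 𝓕 : Finset (Finset V) =>
      (∀ T ∈ 𝓕, G.IsNClique 3 T) ∧ (𝓕 : Set (Finset V)).PairwiseDisjoint id) 𝓕 := by
    obtain ⟨𝓕, -, h⟩ := Set.Finite.exists_le_maximal (Set.toFinite {𝓕 : Finset (Finset V) |
      (∀ T ∈ 𝓕, G.IsNClique 3 T) ∧ (𝓕 : Set (Finset V)).PairwiseDisjoint id})
      (a := ∅) (by simp)
    exact ⟨𝓕, h⟩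
  have huniq : ∀ S ∈ 𝓕, ∀ T ∈ 𝓕, ∀ v, v ∈ S → v ∈ T → S = T := fun S hS T hT v hvS hvT =>
    h𝓕.prop.2.elim_finset hS hT v hvS hvT
  let r : V → Finset V := fun v => if h : ∃ T ∈ 𝓕, v ∈ T then h.choose else {v}
  have hr : ∀ T ∈ 𝓕, ∀ v ∈ T, r v = T := by
    intro T hT v hv
    have h : ∃ T ∈ 𝓕, v ∈ T := ⟨T, hT, hv⟩
    simp only [r, dif_pos h]
    exact huniq _ h.choose_spec.1 _ hT v h.choose_spec.2 hv
  have hr' : ∀ v, (∃ T ∈ 𝓕, v ∈ T ∧ r v = T) ∨ r v = {v} := by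
    intro v
    by_cases h : ∃ T ∈ 𝓕, v ∈ T
    · obtain ⟨T, hT, hv⟩ := h
      exact Or.inl ⟨T, hT, hv, hr T hT v hv⟩
    · exact Or.inr (dif_neg h)
  refine ⟨r, fun v => ?_, fun u v huv => ?_, fun v => ?_, fun T hT => ?_⟩
  · rcases hr' v with ⟨T, -, hv, h⟩ | h
    · rwa [h]
    · simp [h]
  · rcases hr' v with ⟨T, hT, hv, h⟩ | h
    · rw [h] at huv ⊢
      exact hr T hT u huv
    · rw [h, Finset.mem_singleton] at huv
      rw [huv]
  · rcases hr' v with ⟨T, hT, hv, h⟩ | h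
    · exact Or.inr (h ▸ h𝓕.prop.1 T hT)
    · left
      simp [h, SimpleGraph.isNClique_iff]
  · by_contra! hne
    have hdisj : ∀ S ∈ 𝓕, Disjoint T S := fun S hS => Finset.disjoint_left.2 fun v hvT hvS =>
      hne v hvT (by rw [hr S hS v hvS]; exact h𝓕.prop.1 S hS)
    have hmem : T ∈ 𝓕 := by
      refine h𝓕.le_of_ge (y := insert T 𝓕) ⟨?_, ?_⟩ (Finset.subset_insert _ _)
        (Finset.mem_insert_self _ _)
      · intro S hS
        rcases Finset.mem_insert.1 hS with rfl | hS
        exacts [hT, h𝓕.prop.1 S hS]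
      · rw [Finset.coe_insert]
        exact h𝓕.prop.2.insert fun S hS _ => hdisj S hS
    have h0 : T = ∅ := by simpa using hdisj T hmem
    have := hT.card_eq
    simp [h0] at this

/-- A matching of the multigraph obtained from `G` by identifying vertices along `r` lifts to a
matching of `G`, with at most one edge at each fibre of `r`. -/
theorem exists_lift_matching {G : SimpleGraph V} {M : SimpleGraph W} {r : V → W}
    (hM : ∀ v u w, M.Adj v u → M.Adj v w → u = w)
    (hG : ∀ w w', M.Adj w w' → ∃ u v, G.Adj u v ∧ r u = w ∧ r v = w') :
    ∃ L : SimpleGraph V, L ≤ G ∧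
      (∀ u v u' v', L.Adj u v → L.Adj u' v' → r u = r u' → u = u' ∧ v = v') ∧
      ∀ w w', M.Adj w w' → ∃ u v, L.Adj u v ∧ r u = w := by
  have hex : ∀ e : M.edgeSet, ∃ f ∈ G.edgeSet, f.map r = e := by
    rintro ⟨⟨w, w'⟩, he⟩
    obtain ⟨u, v, huv, rfl, rfl⟩ := hG w w' he
    exact ⟨s(u, v), huv, rfl⟩
  choose g hgG hgr using hex
  have hgM : ∀ e u v, g e = s(u, v) → (e : Sym2 W) = s(r u, r v) ∧ M.Adj (r u) (r v) := by
    intro e u v h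
    have h1 := hgr e
    rw [h, Sym2.map_mk] at h1
    exact ⟨h1.symm, by rw [← SimpleGraph.mem_edgeSet, h1]; exact e.2⟩
  refine ⟨{ Adj := fun u v => ∃ e, g e = s(u, v)
            symm := ⟨fun u v ⟨e, h⟩ => ⟨e, h.trans Sym2.eq_swap⟩⟩
            loopless := ⟨fun u ⟨e, h⟩ =>
              (G.mem_edgeSet.1 (h ▸ hgG e : s(u, u) ∈ G.edgeSet)).ne rfl⟩ }, ?_, ?_, ?_⟩
  · rintro u v ⟨e, h⟩
    exact (SimpleGraph.mem_edgeSet G).1 (h ▸ hgG e)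
  · rintro u v u' v' ⟨e, h⟩ ⟨e', h'⟩ hr
    obtain ⟨he, hm⟩ := hgM e u v h
    obtain ⟨he', hm'⟩ := hgM e' u' v' h'
    have hrv : r v = r v' := hM _ _ _ hm (hr ▸ hm')
    have hee : e = e' := Subtype.ext (by rw [he, he', hr, hrv])
    rw [← hee, h] at h'
    rcases Sym2.eq_iff.1 h' with h | ⟨rfl, rfl⟩
    · exact h
    · exact absurd hr hm.ne
  · intro w w' hw
    obtain ⟨u, v, huv⟩ : ∃ u v, g ⟨s(w, w'), hw⟩ = s(u, v) := by
      generalize g _ = f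
      obtain ⟨u, v⟩ := f
      exact ⟨u, v, rfl⟩
    rcases Sym2.eq_iff.1 (hgM _ u v huv).1 with ⟨h, -⟩ | ⟨h, -⟩
    · exact ⟨u, v, ⟨_, huv⟩, h.symm⟩
    · exact ⟨v, u, ⟨_, huv.trans Sym2.eq_swap⟩, h.symm⟩

open scoped Classical in
/-- The number of edges of `G` between the fibres of `r` over `u` and `v`: the multiplicity of `uv`
in the multigraph obtained by identifying vertices along `r` and deleting loops. -/
noncomputable def blockWeight [Fintype V] (G : SimpleGraph V) (r : V → W) (u v : W) : ℕ :=
  if u = v then 0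
  else (Finset.univ.filter fun p : V × V => G.Adj p.1 p.2 ∧ r p.1 = u ∧ r p.2 = v).card

section Weight

variable [Fintype V] {G : SimpleGraph V} {r : V → W}

theorem blockWeight_comm (u v : W) : blockWeight G r u v = blockWeight G r v u := by
  classical
  unfold blockWeight
  by_cases h : u = v
  · simp [h]
  · rw [if_neg h, if_neg (Ne.symm h)]
    refine Finset.card_bij' (fun p _ => p.swap) (fun p _ => p.swap) ?_ ?_ ?_ ?_ <;>
      simp +contextual [SimpleGraph.adj_comm]

theorem blockWeight_self (w : W) : blockWeight G r w w = 0 := if_pos rfl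

theorem exists_adj_of_blockWeight_pos {u v : W} (h : 0 < blockWeight G r u v) :
    ∃ x y, G.Adj x y ∧ r x = u ∧ r y = v := by
  classical
  unfold blockWeight at h
  split_ifs at h with huv
  · exact absurd h (lt_irrefl 0)
  · obtain ⟨p, hp⟩ := Finset.card_pos.1 h
    exact ⟨p.1, p.2, by simpa using hp⟩

open scoped Classical in
theorem sum_blockWeight_cut [Fintype W] [DecidableEq W] (K : Finset W) :
    ∑ u ∈ K, ∑ v ∈ Kᶜ, blockWeight G r u v =
      (Finset.univ.filter fun p : V × V => G.Adj p.1 p.2 ∧ r p.1 ∈ K ∧ r p.2 ∉ K).card := by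
  rw [Finset.card_eq_sum_card_fiberwise (f := fun p : V × V => (r p.1, r p.2)) (t := K ×ˢ Kᶜ),
    Finset.sum_product]
  · refine Finset.sum_congr rfl fun u hu => Finset.sum_congr rfl fun v hv => ?_
    have hv' := Finset.mem_compl.1 hv
    have huv : u ≠ v := by rintro rfl; exact hv' hu
    rw [blockWeight, if_neg huv, Finset.filter_filter]
    congr 1
    ext p
    simp only [Finset.mem_filter, Finset.mem_univ, true_and, Prod.mk.injEq]
    constructor
    · rintro ⟨h, rfl, rfl⟩
      exact ⟨⟨h, hu, hv'⟩, rfl, rfl⟩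
    · rintro ⟨⟨h, -, -⟩, h'⟩
      exact ⟨h, h'⟩
  · intro p hp
    simp only [Finset.coe_filter, Finset.mem_univ, true_and, Set.mem_ofPred_eq] at hp
    simpa using hp.2

open scoped Classical in
theorem sum_blockWeight [Fintype W] [DecidableEq W] (w : W) :
    ∑ v, blockWeight G r w v =
      (Finset.univ.filter fun p : V × V => G.Adj p.1 p.2 ∧ r p.1 = w ∧ r p.2 ≠ w).card := by
  have h := sum_blockWeight_cut (G := G) (r := r) {w}
  have h' := Finset.sum_add_sum_compl {w} (blockWeight G r w)
  simp only [Finset.sum_singleton, Finset.mem_singleton, blockWeight_self, zero_add] at h h'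
  rw [← h', h]

open scoped Classical in
/-- Each vertex of a clique `B` has `B.card - 1` neighbours in `B`; summing the others over `B` gives
the degree of `B` once it is contracted to a vertex. -/
theorem sum_card_outside {B : Finset V} (hB : G.IsClique (B : Set V)) :
    ∑ v ∈ B, (Finset.univ.filter fun u => G.Adj v u ∧ u ∉ B).card + B.card * (B.card - 1)
      = ∑ v ∈ B, (Finset.univ.filter (G.Adj v)).card := by
  rw [← smul_eq_mul, ← Finset.sum_const, ← Finset.sum_add_distrib]
  refine Finset.sum_congr rfl fun v hv => ?_
  rw [← Finset.card_erase_of_mem hv, ← Finset.card_union_of_disjoint]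
  · congr 1
    ext u
    simp only [Finset.mem_union, Finset.mem_filter, Finset.mem_univ, true_and, Finset.mem_erase]
    have h' : G.Adj v u → u ≠ v := fun h => h.ne'
    have h'' : u ∈ B → u ≠ v → G.Adj v u := fun h hne => hB hv h hne.symm
    tauto
  · refine Finset.disjoint_left.2 fun u hu hu' => ?_
    exact (Finset.mem_filter.1 hu).2.2 (Finset.mem_of_mem_erase hu')

end Weight

end Blocks

/-! ### A matching that meets every triangle -/

section Matching

variable {V : Type*} [Fintype V] {G : SimpleGraph V}

open scoped Classical in
theorem sum_blockWeight_block {r : V → Finset V} (hr : ∀ v, v ∈ r v)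
    (hr' : ∀ u v, u ∈ r v → r u = r v) (v₀ : V) :
    ∑ w, blockWeight G r (r v₀) w =
      ∑ v ∈ r v₀, (Finset.univ.filter fun u => G.Adj v u ∧ u ∉ r v₀).card := by
  have hiff : ∀ v, r v = r v₀ ↔ v ∈ r v₀ := fun v => ⟨fun h => h ▸ hr v, hr' v v₀⟩
  rw [sum_blockWeight]
  simp only [ne_eq, hiff, Finset.card_filter, Fintype.sum_prod_type]
  rw [← Finset.sum_subset (Finset.subset_univ (r v₀))]
  · refine Finset.sum_congr rfl fun v hv => Finset.sum_congr rfl fun u _ => ?_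
    simp [hv]
  · intro v _ hv
    simp [hv]

open scoped Classical in
/-- In a bridgeless graph of maximum degree at most `3`, a matching `L` covers all vertices of degree
`3`, except that in each triangle of the partition given by `r` two vertices are left uncovered. The
third vertex, `p B` for the triangle `B`, is covered if it has degree `3`. -/
theorem exists_matching_of_blocks [Nonempty V] {r : V → Finset V} (hr : ∀ v, v ∈ r v)
    (hr' : ∀ u v, u ∈ r v → r u = r v)
    (hclique : ∀ v, G.IsNClique 1 (r v) ∨ G.IsNClique 3 (r v))
    (hdeg : ∀ v, (Finset.univ.filter (G.Adj v)).card ≤ 3)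
    (hcut : ∀ S : Finset V,
      (Finset.univ.filter fun p : V × V => G.Adj p.1 p.2 ∧ p.1 ∈ S ∧ p.2 ∉ S).card ≠ 1) :
    ∃ (L : SimpleGraph V) (p : Finset V → V), L ≤ G ∧
      (∀ v u w, L.Adj v u → L.Adj v w → u = w) ∧
      ∀ v, p (r v) ∈ r v ∧ (∀ u w, u ∈ r v → L.Adj u w → u = p (r v)) ∧
        ((Finset.univ.filter (G.Adj (p (r v)))).card = 3 → ∃ u, L.Adj (p (r v)) u) := by
  have hsum : ∀ v₀, ∑ w, blockWeight G r (r v₀) w + (r v₀).card * ((r v₀).card - 1)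
      = ∑ v ∈ r v₀, (Finset.univ.filter (G.Adj v)).card := by
    intro v₀
    rw [sum_blockWeight_block hr hr', sum_card_outside]
    rcases hclique v₀ with h | h <;> exact h.isClique
  have hcard : ∀ v, (r v).card = 1 ∨ (r v).card = 3 := fun v =>
    (hclique v).imp (fun h => h.card_eq) (fun h => h.card_eq)
  have hle : ∀ w, ∑ v, blockWeight G r w v ≤ 3 := by
    intro w
    by_cases hw : ∃ v₀, r v₀ = w
    · obtain ⟨v₀, rfl⟩ := hw
      have h1 := hsum v₀
      have h2 : ∑ v ∈ r v₀, (Finset.univ.filter (G.Adj v)).card ≤ ∑ v ∈ r v₀, 3 :=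
        Finset.sum_le_sum fun v _ => hdeg v
      rw [Finset.sum_const, smul_eq_mul] at h2
      rcases hcard v₀ with h | h <;> rw [h] at h1 h2 <;> omega
    · rw [sum_blockWeight, Finset.filter_false_of_mem]
      · simp
      · exact fun p _ h => hw ⟨_, h.2.1⟩
  obtain ⟨N, hN0, hNm, hNc⟩ : ∃ N : SimpleGraph (Finset V),
      (∀ u v, N.Adj u v → 0 < blockWeight G r u v) ∧
      (∀ v u w, N.Adj v u → N.Adj v w → u = w) ∧
      ∀ w, ∑ v, blockWeight G r w v = 3 → ∃ v, N.Adj w v := by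
    refine exists_matching_of_cut_ne_one ?_ blockWeight_comm blockWeight_self hle fun K => ?_
    -- the number `2 ^ |V|` of sets of vertices is even, as Tutte's theorem needs
    · rw [Fintype.card_finset]
      exact Nat.even_pow.2 ⟨even_two, Fintype.card_ne_zero⟩
    · rw [sum_blockWeight_cut]
      have := hcut (Finset.univ.filter fun v => r v ∈ K)
      simpa only [Finset.mem_filter, Finset.mem_univ, true_and] using this
  obtain ⟨L, hLG, hLm, hLc⟩ := exists_lift_matching hNm fun w w' h =>
    exists_adj_of_blockWeight_pos (hN0 w w' h)
  have hp : ∀ B : Finset V, ∃ p : V, ∀ v, r v = B → p ∈ B ∧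
      (∀ u w, u ∈ B → L.Adj u w → u = p) ∧
      ((Finset.univ.filter (G.Adj p)).card = 3 → ∃ u, L.Adj p u) := by
    intro B
    by_cases hB : ∃ v, r v = B
    · obtain ⟨v₀, rfl⟩ := hB
      by_cases hL : ∃ u ∈ r v₀, ∃ w, L.Adj u w
      · obtain ⟨p, hp, w, hpw⟩ := hL
        exact ⟨p, fun v _ => ⟨hp, fun u w' hu huw =>
          (hLm u w' p w huw hpw ((hr' u _ hu).trans (hr' p _ hp).symm)).1, fun _ => ⟨w, hpw⟩⟩⟩
      · -- an uncovered block has degree at most `2`, so not all its vertices have degree `3`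
        obtain ⟨p, hp, hpd⟩ : ∃ p ∈ r v₀, (Finset.univ.filter (G.Adj p)).card ≠ 3 := by
          by_contra! hall
          have h1 := hsum v₀
          rw [Finset.sum_congr rfl hall, Finset.sum_const, smul_eq_mul] at h1
          obtain ⟨B, hB⟩ := hNc (r v₀) (by rcases hcard v₀ with h | h <;> rw [h] at h1 <;> omega)
          obtain ⟨u, w, huw, hu⟩ := hLc _ _ hB
          exact hL ⟨u, hu ▸ hr u, w, huw⟩
        exact ⟨p, fun v _ => ⟨hp, fun u w hu huw => absurd ⟨u, hu, w, huw⟩ hL,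
          fun h => absurd h hpd⟩⟩
    · exact ⟨Classical.arbitrary V, fun v hv => absurd ⟨v, hv⟩ hB⟩
  choose p hp using hp
  exact ⟨L, p, hLG, fun v u w hu hw => (hLm v u v w hu hw rfl).2, fun v => hp _ v rfl⟩

open scoped Classical in
/-- A bridgeless graph of maximum degree at most `3` has a matching that covers all vertices of
degree `3` and contains an edge of every triangle. -/
theorem exists_matching_meeting_triangles [Nonempty V]
    (hdeg : ∀ v, (Finset.univ.filter (G.Adj v)).card ≤ 3)
    (hcut : ∀ S : Finset V,
      (Finset.univ.filter fun p : V × V => G.Adj p.1 p.2 ∧ p.1 ∈ S ∧ p.2 ∉ S).card ≠ 1) :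
    ∃ M : SimpleGraph V, (∀ v u w, M.Adj v u → M.Adj v w → u = w) ∧
      (∀ v, (Finset.univ.filter (G.Adj v)).card = 3 → ∃ u, G.Adj v u ∧ M.Adj v u) ∧
      ∀ a b c, G.Adj a b → G.Adj b c → G.Adj a c → M.Adj a b ∨ M.Adj b c ∨ M.Adj a c := by
  obtain ⟨r, hr, hr', hclique, hmeet⟩ := exists_triangle_blocks G
  obtain ⟨L, p, hLG, hLm, hLp⟩ := exists_matching_of_blocks hr hr' hclique hdeg hcut
  have htri : ∀ v w, w ∈ r v → v ≠ w → G.IsNClique 3 (r v) := by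
    intro v w hw hvw
    refine (hclique v).resolve_left fun h => hvw ?_
    exact Finset.card_le_one.1 h.card_eq.le _ (hr v) _ hw
  -- add to `L`, in each triangle `B` of the partition, the edge that avoids `p B`
  let M : SimpleGraph V :=
    { Adj := fun u v => L.Adj u v ∨ (u ≠ v ∧ r u = r v ∧ u ≠ p (r u) ∧ v ≠ p (r v))
      symm := ⟨fun u v h => Or.imp (fun h => h.symm)
        (fun h => ⟨h.1.symm, h.2.1.symm, h.2.2.2, h.2.2.1⟩) h⟩
      loopless := ⟨fun u h => h.elim (fun h => h.ne rfl) fun h => h.1 rfl⟩ }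
  have hMG : ∀ u v, M.Adj u v → G.Adj u v := by
    rintro u v (h | ⟨hne, hruv, -, -⟩)
    · exact hLG h
    · have hv : v ∈ r u := hruv ▸ hr v
      exact (htri u v hv hne).isClique (hr u) hv hne
  have hMm : ∀ v u w, M.Adj v u → M.Adj v w → u = w := by
    rintro v u w (hu | ⟨hvu, hru, hpv, hpu⟩) (hw | ⟨hvw, hrw, hpv', hpw⟩)
    · exact hLm v u w hu hw
    · exact absurd ((hLp v).2.1 v u (hr v) hu) hpv'
    · exact absurd ((hLp v).2.1 v w (hr v) hw) hpv
    · by_contra huw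
      have hu : u ∈ r v := hru ▸ hr u
      have hw : w ∈ r v := hrw ▸ hr w
      rw [← hru] at hpu
      rw [← hrw] at hpw
      have hsub : ({p (r v), v, u, w} : Finset V) ⊆ r v := by
        intro x hx
        simp only [Finset.mem_insert, Finset.mem_singleton] at hx
        rcases hx with rfl | rfl | rfl | rfl
        exacts [(hLp v).1, hr _, hu, hw]
      have h4 : ({p (r v), v, u, w} : Finset V).card = 4 := by
        rw [Finset.card_insert_of_notMem, Finset.card_eq_three.2 ⟨v, u, w, hvu, hvw, huw, rfl⟩]
        simp [Ne.symm hpv, Ne.symm hpu, Ne.symm hpw]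
      have := Finset.card_le_card hsub
      rw [h4, (htri v u hu hvu).card_eq] at this
      omega
  have hMc : ∀ v, (Finset.univ.filter (G.Adj v)).card = 3 → ∃ u, M.Adj v u := by
    intro v hv
    by_cases hpv : v = p (r v)
    · obtain ⟨u, hu⟩ := (hLp v).2.2 (hpv ▸ hv)
      exact ⟨u, Or.inl (hpv ▸ hu)⟩
    · obtain ⟨u, hu⟩ : (r v \ {v, p (r v)}).Nonempty := by
        rw [← Finset.card_pos]
        have h1 := Finset.le_card_sdiff {v, p (r v)} (r v)
        rw [(htri v _ (hLp v).1 hpv).card_eq, Finset.card_pair hpv] at h1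
        omega
      simp only [Finset.mem_sdiff, Finset.mem_insert, Finset.mem_singleton, not_or] at hu
      have hru := hr' u v hu.1
      exact ⟨u, Or.inr ⟨Ne.symm hu.2.1, hru.symm, hpv, hru ▸ hu.2.2⟩⟩
  -- the case in which `ab` is an edge of a block `{a, b, y}`
  have hab : ∀ a b c, G.Adj a b → G.Adj b c → G.Adj a c → G.IsNClique 3 (r a) → b ∈ r a →
      M.Adj a b ∨ M.Adj b c ∨ M.Adj a c := by
    intro a b c gab gbc gac hB hb
    obtain ⟨y, hy⟩ : (r a \ {a, b}).Nonempty := by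
      rw [← Finset.card_pos]
      have h1 := Finset.le_card_sdiff {a, b} (r a)
      rw [hB.card_eq, Finset.card_pair gab.ne] at h1
      omega
    simp only [Finset.mem_sdiff, Finset.mem_insert, Finset.mem_singleton, not_or] at hy
    obtain ⟨hyB, hya, hyb⟩ := hy
    have hrb := hr' b a hb
    by_cases hyc : y = c
    · subst hyc
      have hry := hr' y a hyB
      have h1 : ∀ u w, u ≠ w → r u = r a → r w = r a → u ≠ p (r a) → w ≠ p (r a) → M.Adj u w :=
        fun u w hne hu hw hpu hpw => Or.inr ⟨hne, hu.trans hw.symm, by rwa [hu], by rwa [hw]⟩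
      by_cases hpa : a = p (r a)
      · exact Or.inr (Or.inl (h1 b y gbc.ne hrb hry (hpa ▸ gab.ne') (hpa ▸ gac.ne')))
      · by_cases hpb : b = p (r a)
        · exact Or.inr (Or.inr (h1 a y gac.ne rfl hry hpa (hpb ▸ gbc.ne')))
        · exact Or.inl (h1 a b gab.ne rfl hrb hpa hpb)
    -- now `a` and `b` have degree `3`; without the edges of `abc`, both would be matched to `y`
    · have gay : G.Adj a y := hB.isClique (hr a) hyB (Ne.symm hya)
      have gby : G.Adj b y := hB.isClique hb hyB (Ne.symm hyb)
      have hNa := filter_adj_eq_of_card_le_three (hdeg a) gab gac gay gbc.ne (Ne.symm hyb)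
        (Ne.symm hyc)
      have hNb := filter_adj_eq_of_card_le_three (hdeg b) gab.symm gbc gby gac.ne (Ne.symm hya)
        (Ne.symm hyc)
      obtain ⟨m, hm⟩ := hMc a (hNa ▸ Finset.card_eq_three.2
        ⟨b, c, y, gbc.ne, Ne.symm hyb, Ne.symm hyc, rfl⟩)
      obtain ⟨n, hn⟩ := hMc b (hNb ▸ Finset.card_eq_three.2
        ⟨a, c, y, gac.ne, Ne.symm hya, Ne.symm hyc, rfl⟩)
      have hm' : m ∈ Finset.univ.filter (G.Adj a) := by simpa using hMG _ _ hm
      have hn' : n ∈ Finset.univ.filter (G.Adj b) := by simpa using hMG _ _ hn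
      simp only [hNa, hNb, Finset.mem_insert, Finset.mem_singleton] at hm' hn'
      rcases hm' with rfl | rfl | rfl
      · exact Or.inl hm
      · exact Or.inr (Or.inr hm)
      · rcases hn' with rfl | rfl | rfl
        · exact Or.inl hn.symm
        · exact Or.inr (Or.inl hn)
        · exact absurd (hMm _ _ _ hm.symm hn.symm) gab.ne
  have ha : ∀ a b c, G.Adj a b → G.Adj b c → G.Adj a c → G.IsNClique 3 (r a) →
      M.Adj a b ∨ M.Adj b c ∨ M.Adj a c := by
    intro a b c gab gbc gac hB
    by_cases hb : b ∈ r a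
    · exact hab a b c gab gbc gac hB hb
    by_cases hc : c ∈ r a
    · rcases hab a c b gac gbc.symm gab hB hc with h | h | h
      exacts [Or.inr (Or.inr h), Or.inr (Or.inl h.symm), Or.inl h]
    -- the two vertices of the block other than `a`, together with `b` and `c`, are too many
    exfalso
    have hsub : insert b (insert c ((r a).erase a)) ⊆ Finset.univ.filter (G.Adj a) := by
      intro x hx
      simp only [Finset.mem_insert, Finset.mem_erase] at hx
      simp only [Finset.mem_filter, Finset.mem_univ, true_and]
      rcases hx with rfl | rfl | ⟨hxa, hx⟩
      exacts [gab, gac, hB.isClique (hr a) hx (Ne.symm hxa)]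
    have h1 := Finset.card_le_card hsub
    rw [Finset.card_insert_of_notMem (by simp [hb, gbc.ne]),
      Finset.card_insert_of_notMem (by simp [hc]), Finset.card_erase_of_mem (hr a),
      hB.card_eq] at h1
    have := hdeg a
    omega
  refine ⟨M, hMm, fun v hv => ?_, fun a b c gab gbc gac => ?_⟩
  · obtain ⟨u, hu⟩ := hMc v hv
    exact ⟨u, hMG v u hu, hu⟩
  · obtain ⟨v, hv, hB⟩ := hmeet {a, b, c} (SimpleGraph.is3Clique_triple_iff.2 ⟨gab, gac, gbc⟩)
    simp only [Finset.mem_insert, Finset.mem_singleton] at hv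
    rcases hv with rfl | rfl | rfl
    · exact ha v b c gab gbc gac hB
    · rcases ha v c a gbc gac.symm gab.symm hB with h | h | h
      exacts [Or.inr (Or.inl h), Or.inr (Or.inr h.symm), Or.inl h.symm]
    · rcases ha v a b gac.symm gab gbc.symm hB with h | h | h
      exacts [Or.inr (Or.inr h.symm), Or.inl h, Or.inr (Or.inl h.symm)]

/-! ### The proper disconnection number -/

open scoped Classical in
/-- A graph of maximum degree at most `3` has an edge-colouring with two colours in which proper
cuts separate any two vertices. Bridges are removed one by one. -/
theorem exists_hasProperSides (G : SimpleGraph V)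
    (hdeg : ∀ v, (Finset.univ.filter (G.Adj v)).card ≤ 3) :
    ∃ c : Sym2 V → Bool, HasProperSides G c := by
  induction G using WellFoundedLT.induction with
  | ind G ih =>
    rcases isEmpty_or_nonempty V with hV | hV
    · exact ⟨fun _ => true, fun x => hV.elim x⟩
    by_cases hcut : ∀ S : Finset V,
        (Finset.univ.filter fun p : V × V => G.Adj p.1 p.2 ∧ p.1 ∈ S ∧ p.2 ∉ S).card ≠ 1
    · obtain ⟨M, hMm, hMc, hMt⟩ := exists_matching_meeting_triangles hdeg hcut
      exact ⟨_, hasProperSides_of_matching hdeg hMm hMc hMt⟩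
    · push Not at hcut
      obtain ⟨S, hS⟩ := hcut
      obtain ⟨⟨a, b⟩, hab⟩ := Finset.card_eq_one.1 hS
      have hiff : ∀ u v, (G.Adj u v ∧ u ∈ S ∧ v ∉ S) ↔ u = a ∧ v = b := by
        intro u v
        simpa using Finset.ext_iff.1 hab (u, v)
      obtain ⟨hadj, ha, hb⟩ := (hiff a b).2 ⟨rfl, rfl⟩
      have hle : G.deleteEdges {s(a, b)} ≤ G := SimpleGraph.deleteEdges_le _
      obtain ⟨c, hc⟩ := ih (G.deleteEdges {s(a, b)})
        (lt_of_le_of_ne hle fun h => by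
          rw [← h, SimpleGraph.deleteEdges_adj] at hadj
          exact hadj.2 rfl)
        (fun v => (Finset.card_le_card fun u hu => by
          simp only [Finset.mem_filter, Finset.mem_univ, true_and] at hu ⊢
          exact hle hu).trans (hdeg v))
      exact ⟨c, HasProperSides.of_deleteEdges_bridge (K := (S : Set V)) ha hb
        (fun u v huv hu hv => (hiff u v).1 ⟨huv, hu, hv⟩) hc⟩

/-- With a single colour, the proper edge-cuts are the matching cuts. -/
theorem isProperEdgeCut_iff_isMatchingCut {V K : Type*} [Subsingleton K] {G : SimpleGraph V}
    (c : G.EdgeLabeling K) (F : Set (Sym2 V)) : IsProperEdgeCut G c F ↔ IsMatchingCut G F := by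
  constructor
  · rintro ⟨h, h'⟩
    exact ⟨h, fun e he f hf hne hv => h' ⟨e, h.1 he⟩ ⟨f, h.1 hf⟩ he hf
      (fun h => hne (congrArg Subtype.val h)) hv (Subsingleton.elim _ _)⟩
  · rintro ⟨h, h'⟩
    exact ⟨h, fun e f he hf hne hv => absurd hv (h' e he f hf fun h => hne (Subtype.ext h))⟩

theorem pd_eq_one_iff {V : Type*} [Finite V] (G : SimpleGraph V) :
    pd G = 1 ↔ ∀ x y : V, x ≠ y → ∃ F : Set (Sym2 V), IsMatchingCut G F ∧ Separates G F x y := by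
  constructor
  · intro h
    have hmem := Nat.sInf_mem (pd_set_nonempty G)
    rw [show sInf _ = 1 from h] at hmem
    obtain ⟨-, c, hc⟩ := hmem
    simpa only [IsProperDisconnected, isProperEdgeCut_iff_isMatchingCut] using hc
  · intro h
    refine le_antisymm (Nat.sInf_le ⟨one_pos, fun _ => 0, ?_⟩)
      (Nat.sInf_mem (pd_set_nonempty G)).1
    intro x y hxy
    obtain ⟨F, hF, hs⟩ := h x y hxy
    exact ⟨F, (isProperEdgeCut_iff_isMatchingCut _ F).2 hF, hs⟩

end Matching

end ProperDisconnection

theorem mainTheorem1 {V : Type*} [Fintype V] (G : SimpleGraph V) [DecidableRel G.Adj]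
    (hΔ : G.maxDegree = 3) :
    ProperDisconnection.pd G ≤ 2 ∧
    (ProperDisconnection.pd G = 1 ↔
      ∀ x y : V, x ≠ y → ∃ F : Set (Sym2 V),
        ProperDisconnection.IsMatchingCut G F ∧ ProperDisconnection.Separates G F x y) ∧
    ((¬ ∀ x y : V, x ≠ y → ∃ F : Set (Sym2 V),
        ProperDisconnection.IsMatchingCut G F ∧ ProperDisconnection.Separates G F x y) →
      ProperDisconnection.pd G = 2) := by
  obtain ⟨c, hc⟩ := ProperDisconnection.exists_hasProperSides G fun v => by
    have h := G.degree_le_maxDegree v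
    rw [hΔ, ← SimpleGraph.card_neighborFinset_eq_degree, SimpleGraph.neighborFinset_eq_filter] at h
    convert h
  have h2 : ProperDisconnection.pd G ≤ 2 := Nat.sInf_le ⟨two_pos, _, hc.isProperDisconnected⟩
  have h0 : 0 < ProperDisconnection.pd G :=
    (Nat.sInf_mem (ProperDisconnection.pd_set_nonempty G)).1
  refine ⟨h2, ProperDisconnection.pd_eq_one_iff G, fun h => ?_⟩
  rw [← ProperDisconnection.pd_eq_one_iff] at h
  omega
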